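/- For a field $F$, let $s_4(F)\in\{1,2,3,\dots\}\cup\{\infty\}$ denote the smallest positive integer $g$ such that $x_1^4+\dots+x_g^4=-1$ is solvable in $F$ (and $s_4(F)=\infty$ if there is none). For an ideal $\mathfrak p$ of a commutative ring write $\mathfrak p^k\mid a$ for $a\in\mathfrak p^k$, and $\mathfrak p^k\parallel a$ for $a\in\mathfrak p^k\setminus\mathfrak p^{k+1}$. **Theorem.** Let $K$ be a number field and let $\mathfrak p\mid(2)$ be a prime ideal of $\mathcal O_K$ with ramification index $e(\mathfrak p)=4$ and inertia degree $f(\mathfrak p)=1$ over $\mathbb Q$. Let $\tau$ be any element of $\mathfrak p\setminus\mathfrak p^2$, and let $s=s_4(K_{\mathfrak p})$, where $K_{\mathfrak p}$ is the $\mathfrak p$-adic completion of $K$. Then $s\in\{1,2,3,4,5,6\}$. Moreover $\mathfrak p^5\mid\tau^4+2$, so that exactly one of the following nine cases occurs, and $s$ is determined as follows. 1. If $\mathfrak p^5\parallel\tau^4+2$, then $s\in\{3,4,5,6\}$, and - $s=3$ iff $\mathfrak p^{13}\mid\tau^{12}+\tau^8+2\tau^6+4\tau^3+4$; - $s=4$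 iff $\mathfrak p^{13}\mid\tau^8+2\tau^6+4\tau^3+4$; - $s=5$ iff $\mathfrak p^{13}\mid\tau^8+4\tau^3+4\tau^2+4$; - $s=6$ iff $\mathfrak p^{13}\mid\tau^{12}+\tau^8+4\tau^3+4\tau^2+4$. 2. If $\mathfrak p^6\parallel\tau^4+2$, put $A_1=4\tau^3+4\tau^2+4\tau+(\tau^4+2\tau^2+2)$, $A_2=4\tau+(\tau^4+1)(\tau^4+2\tau^2+2)$, $A_3=4\tau+(\tau^4+2\tau^2+2)$, $A_4=4\tau^3+4\tau^2+4\tau+(\tau^4+1)(\tau^4+2\tau^2+2)$. Then $s\in\{1,2,3\}$, and - $s=1$ iff $\mathfrak p^{13}\mid A_i$ for at least one $i\in\{1,2,3,4\}$; - $s=2$ iff $A_i\in\mathfrak p^{12}\setminus\mathfrak p^{13}$ for at least one $i$, or $\mathfrak p^{12}\mid A_i+\tau^8$ for at least one $i$; - $s=3$ otherwise. 3. If $\mathfrak p^7\parallel\tau^4+2$, then $s=3$ if $\mathfrak p^{13}\mid\tau^{12}+4\tau^3+2(\tau^4+2)$, and $s=4$ otherwise. 4. If $\mathfrak p^8\parallel\tau^4+2$,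 put $\beta=\tau^8+\tau^4+2$. Then $s\in\{2,3,4\}$, and - $s=2$ iff $\mathfrak p^{13}$ divides at least one of $\beta$, $4\tau^2+\beta$, $\tau^{12}+4\tau^3+\beta$, $\tau^{12}+4\tau^3+4\tau^2+\beta$; - $s=3$ iff $\mathfrak p^{13}$ divides at least one of $\tau^{12}+\beta$, $\tau^{12}+4\tau^2+\beta$, $4\tau^3+\beta$, $4\tau^3+4\tau^2+\beta$; - $s=4$ iff $\mathfrak p^9\parallel\beta$. 5. If $\mathfrak p^9\parallel\tau^4+2$, then $s=4$. 6. If $\mathfrak p^{10}\parallel\tau^4+2$, then $s=2$ if $\mathfrak p^{13}\mid\tau^{12}+4\tau^3+4\tau^2+\tau^4+2$ or $\mathfrak p^{13}\mid\tau^{12}+4\tau^2+\tau^4+2$, and $s=3$ otherwise. 7. If $\mathfrak p^{11}\parallel\tau^4+2$, then $s=2$ if $\mathfrak p^{13}\mid4\tau^3+\tau^4+2$, and $s=3$ otherwise. 8. If $\mathfrak p^{12}\parallel\tau^4+2$, then $s=3$. 9. If $\mathfrak p^{13}\mid\tau^4+2$, then $s=2$. -/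

import Mathlib

open NumberField IsDedekindDomain

/-- The fourth level of a field `F`: the least positive integer `g` such that
`x₁ ^ 4 + ⋯ + x_g ^ 4 = -1` is solvable in `F`, and `⊤` (infinity) if there is no such `g`. -/
noncomputable def fourthLevel (F : Type*) [Field F] : ℕ∞ :=
  sInf {s : ℕ∞ | ∃ g : ℕ, 0 < g ∧ s = (g : ℕ∞) ∧ ∃ x : Fin g → F, ∑ i, x i ^ 4 = -1}

/-- `P ^ k ∥ a`: the element `a` lies in `P ^ k` but not in `P ^ (k + 1)`. -/
def ExactlyDivides {R : Type*} [CommRing R] (P : Ideal R) (k : ℕ) (a : R) : Prop :=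
  a ∈ P ^ k ∧ a ∉ P ^ (k + 1)

/-- The four polynomial expressions `A₁, A₂, A₃, A₄` in `τ`. -/
def exprA {R : Type*} [CommRing R] (τ : R) : Fin 4 → R :=
  ![4 * τ ^ 3 + 4 * τ ^ 2 + 4 * τ + (τ ^ 4 + 2 * τ ^ 2 + 2),
    4 * τ + (τ ^ 4 + 1) * (τ ^ 4 + 2 * τ ^ 2 + 2),
    4 * τ + (τ ^ 4 + 2 * τ ^ 2 + 2),
    4 * τ ^ 3 + 4 * τ ^ 2 + 4 * τ + (τ ^ 4 + 1) * (τ ^ 4 + 2 * τ ^ 2 + 2)]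

/-!
The level `s₄(K_𝔭)` is found by a finite computation in the ring of integers `R` of `K_𝔭` modulo
`τ ^ 13`.

*Reduction to a congruence.* Since `2` is `τ ^ 4` times a unit, every element `1 + τ ^ 13 r` of `R`
is a fourth power: `(1 + τ ^ 5 y) ^ 4 = 1 + τ ^ 13 (v y + ⋯)` with a unit `v`, so Hensel's lemma
applies (`exists_pow_four_eq`). Dividing a relation `1 + ∑ xᵢ ^ 4 = 0` by its term of largest
valuation makes all terms integral and one of them `1` (`Valuation.exists_sum_eq_neg_one`). Hence
`-1` is a sum of `g` fourth powers in `K_𝔭` if and only if `1 + ∑ yᵢ ^ 4 ≡ 0` modulo `τ ^ 13` is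
solvable in `R` with `g` summands `yᵢ ^ 4`.

*Finiteness.* The residue field has two elements, so every element of `R` is congruent modulo
`τ ^ 13` to some `a + b τ + c τ ^ 2 + d τ ^ 3` with natural coefficients
(`IsDyadicUniformizer.exists_quad`). Writing `τ ^ 4 = 2 u` in this way, the ring `R ⧸ τ ^ 13` and
the divisibility of its elements by powers of `τ` depend on `u = (a, b, c, d)` only, and only on
`a` modulo `8` and `b, c, d` modulo `4`, with `a` odd: there are `256` cases
(`LevelTable.congr`, `IsDyadicUniformizer.divides_iff`). Modulo `τ ^ 13` a fourth power is one of
the values of sixteen fixed integral polynomials at `τ` (`mem_residues`), and for each `u` the least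
number of them that add up to `-1`, together with all the divisibilities in the statement, is
computed in the kernel (`tableHolds_all`).

*Transfer.* The elements of `𝓞 K` are dense in `R` and `𝔭 ^ k` is cut out by the valuation, so a
divisibility in `𝓞 K` by a power of `𝔭` is one in `R` by a power of `τ`
(`pow_dvd_algebraMap_iff`). The hypothesis `e = 4` says that `2` has valuation exactly `4`, and
`f = 1` that the residue field has two elements.
-/

/-! ### Arithmetic of the truncated ring -/

/-- A quadruple of natural numbers, standing for the element `a + b t + c t ^ 2 + d t ^ 3` of a ring
in which `t` is a given element; see `Quad.eval`. -/
@[ext]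
structure Quad where
  /-- The constant coefficient. -/
  a : ℕ
  /-- The coefficient of `t`. -/
  b : ℕ
  /-- The coefficient of `t ^ 2`. -/
  c : ℕ
  /-- The coefficient of `t ^ 3`. -/
  d : ℕ

namespace Quad

/-- The element of the ring `A` that a quadruple stands for. -/
def eval {A : Type*} [CommRing A] (t : A) (q : Quad) : A :=
  q.a + q.b * t + q.c * t ^ 2 + q.d * t ^ 3

/-- Coefficientwise addition. -/
def add (p q : Quad) : Quad := ⟨p.a + q.a, p.b + q.b, p.c + q.c, p.d + q.d⟩

/-- Multiplication by a natural number. -/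
def smul (n : ℕ) (q : Quad) : Quad := ⟨n * q.a, n * q.b, n * q.c, n * q.d⟩

/-- Multiplication by `t` when `t ^ 4 = 2 u`. -/
def shift (u q : Quad) : Quad :=
  ⟨2 * u.a * q.d, q.a + 2 * u.b * q.d, q.b + 2 * u.c * q.d, q.c + 2 * u.d * q.d⟩

/-- Reduction of the coefficients when `16 = 0` and `8 t = 0`. -/
def reduce (q : Quad) : Quad := ⟨q.a % 16, q.b % 8, q.c % 8, q.d % 8⟩

/-- The reduced forms of `q, t q, …, t ^ (n - 1) q`, for `q` reduced and `t ^ 4 = 2 u`. -/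
def powers (u : Quad) : ℕ → Quad → List Quad
  | 0, _ => []
  | n + 1, q => q :: powers u n (shift u q).reduce

/-- The linear combination of a list of quadruples with given coefficients. -/
def dot : List ℕ → List Quad → Quad
  | n :: l, q :: ps => (smul n q).add (dot l ps)
  | _, _ => ⟨0, 0, 0, 0⟩

/-- The test for divisibility by `t ^ k`, when `t` is a uniformizer and `2` has valuation `4`. -/
def divides : ℕ → Quad → Bool
  | 0, _ => true
  | 1, q => Nat.beq (q.a % 2) 0
  | 2, q => Nat.beq (q.a % 2) 0 && Nat.beq (q.b % 2) 0
  | 3, q => Nat.beq (q.a % 2) 0 && Nat.beq (q.b % 2) 0 && Nat.beq (q.c % 2) 0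
  | k + 4, q => Nat.beq (q.a % 2) 0 && Nat.beq (q.b % 2) 0 && Nat.beq (q.c % 2) 0 &&
      Nat.beq (q.d % 2) 0 && divides k ⟨q.a / 2, q.b / 2, q.c / 2, q.d / 2⟩

/-- The four coefficients as the digits of one natural number in base `2 ^ 16`. Sums of packed
quadruples are packed sums, and this is much faster in the kernel than adding structures. -/
def pack (q : Quad) : ℕ := q.a + 2 ^ 16 * q.b + 2 ^ 32 * q.c + 2 ^ 48 * q.d

/-- The inverse of `pack` on quadruples with coefficients below `2 ^ 16`. -/
def unpack (n : ℕ) : Quad :=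
  ⟨n % 2 ^ 16, n / 2 ^ 16 % 2 ^ 16, n / 2 ^ 32 % 2 ^ 16, n / 2 ^ 48⟩

/-- All four coefficients are at most `m`. -/
def Bounded (m : ℕ) (q : Quad) : Prop := q.a ≤ m ∧ q.b ≤ m ∧ q.c ≤ m ∧ q.d ≤ m

theorem pack_add (p q : Quad) : (p.add q).pack = p.pack + q.pack := by
  simp only [pack, add]; ring

theorem pack_smul (n : ℕ) (q : Quad) : (smul n q).pack = n * q.pack := by
  simp only [pack, smul]; ring

theorem unpack_pack {q : Quad} (hq : q.Bounded 65535) : unpack q.pack = q := by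
  obtain ⟨a, b, c, d⟩ := q
  obtain ⟨ha, hb, hc, hd⟩ := hq
  dsimp only at ha hb hc hd
  ext <;> simp only [pack, unpack] <;> omega

theorem Bounded.add {p q : Quad} {m n : ℕ} (hp : p.Bounded m) (hq : q.Bounded n) :
    (p.add q).Bounded (m + n) :=
  ⟨Nat.add_le_add hp.1 hq.1, Nat.add_le_add hp.2.1 hq.2.1, Nat.add_le_add hp.2.2.1 hq.2.2.1,
    Nat.add_le_add hp.2.2.2 hq.2.2.2⟩

theorem Bounded.mono {q : Quad} {m n : ℕ} (hq : q.Bounded m) (h : m ≤ n) : q.Bounded n :=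
  ⟨hq.1.trans h, hq.2.1.trans h, hq.2.2.1.trans h, hq.2.2.2.trans h⟩

theorem bounded_reduce (q : Quad) : q.reduce.Bounded 15 := by
  refine ⟨?_, ?_, ?_, ?_⟩ <;> simp only [reduce] <;> omega

theorem bounded_powers (u : Quad) (n : ℕ) :
    ∀ q : Quad, q.Bounded 15 → ∀ p ∈ powers u n q, p.Bounded 15 := by
  induction n with
  | zero => simp [powers]
  | succ n ih =>
    intro q hq p hp
    rcases List.mem_cons.1 hp with rfl | hp
    · exact hq
    · exact ih _ (bounded_reduce _) p hp

theorem bounded_dot {m : ℕ} (l : List ℕ) :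
    ∀ ps : List Quad, (∀ p ∈ ps, p.Bounded m) → (dot l ps).Bounded (l.sum * m) := by
  induction l with
  | nil => intro ps _; simp [dot, Bounded]
  | cons n l ih =>
    rintro (_ | ⟨q, ps⟩) h
    · simp [dot, Bounded]
    · have hq := h q (by simp)
      rw [dot, List.sum_cons, add_mul]
      exact Bounded.add ⟨Nat.mul_le_mul_left n hq.1, Nat.mul_le_mul_left n hq.2.1,
        Nat.mul_le_mul_left n hq.2.2.1, Nat.mul_le_mul_left n hq.2.2.2⟩
        (ih ps fun p hp => h p (by simp [hp]))

section Eval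

variable {A : Type*} [CommRing A] (t : A)

theorem eval_add (p q : Quad) : (p.add q).eval t = p.eval t + q.eval t := by
  simp only [eval, add]; push_cast; ring

theorem eval_smul (n : ℕ) (q : Quad) : (smul n q).eval t = n * q.eval t := by
  simp only [eval, smul]; push_cast; ring

theorem eval_shift {t : A} {u : Quad} (h : t ^ 4 = 2 * u.eval t) (q : Quad) :
    (shift u q).eval t = t * q.eval t := by
  simp only [eval, shift] at h ⊢
  push_cast
  linear_combination (-(q.d : A)) * h

theorem eval_reduce {t : A} (h16 : (16 : A) = 0) (h8 : 8 * t = 0) (q : Quad) :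
    q.reduce.eval t = q.eval t := by
  have key (n m : ℕ) : (n : A) = m * (n / m : ℕ) + (n % m : ℕ) := by
    rw [← Nat.cast_mul, ← Nat.cast_add, Nat.div_add_mod]
  have ha := key q.a 16
  have hb := key q.b 8
  have hc := key q.c 8
  have hd := key q.d 8
  rw [Nat.cast_ofNat] at ha hb hc hd
  simp only [eval, reduce]
  linear_combination -ha - t * hb - t ^ 2 * hc - t ^ 3 * hd - ((q.a / 16 : ℕ) : A) * h16 -
    ((q.b / 8 : ℕ) + (q.c / 8 : ℕ) * t + (q.d / 8 : ℕ) * t ^ 2 : A) * h8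

end Eval

end Quad

/-! ### Polynomials as lists of coefficients -/

/-- The value at `t` of the polynomial with the given list of coefficients, constant term first. -/
def polyEval {A : Type*} [CommRing A] (t : A) : List ℕ → A
  | [] => 0
  | n :: l => n + t * polyEval t l

/-- Addition of polynomials given by their coefficients. -/
def polyAdd : List ℕ → List ℕ → List ℕ
  | [], m => m
  | n :: l, [] => n :: l
  | n :: l, m :: l' => (n + m) :: polyAdd l l'

/-- Multiplication of polynomials given by their coefficients. -/
def polyMul : List ℕ → List ℕ → List ℕ
  | [], _ => []
  | n :: l, m => polyAdd (m.map (n * ·)) (0 :: polyMul l m)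

section PolyEval

variable {A : Type*} [CommRing A] (t : A)

theorem polyEval_polyAdd (l m : List ℕ) :
    polyEval t (polyAdd l m) = polyEval t l + polyEval t m := by
  induction l, m using polyAdd.induct with
  | case1 m => simp [polyAdd, polyEval]
  | case2 n l => simp [polyAdd, polyEval]
  | case3 n l m l' ih => simp only [polyAdd, polyEval, ih]; push_cast; ring

theorem polyEval_polyMul (l m : List ℕ) :
    polyEval t (polyMul l m) = polyEval t l * polyEval t m := by
  have hmap (n : ℕ) : polyEval t (m.map (n * ·)) = n * polyEval t m := by
    induction m with
    | nil => simp [polyEval]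
    | cons k m ih => simp only [List.map_cons, polyEval, ih]; push_cast; ring
  induction l with
  | nil => simp [polyMul, polyEval]
  | cons n l ih =>
    simp only [polyMul, polyEval_polyAdd, hmap, polyEval, ih]; push_cast; ring

theorem map_polyEval {B : Type*} [CommRing B] (f : A →+* B) (l : List ℕ) :
    f (polyEval t l) = polyEval (f t) l := by
  induction l with
  | nil => simp [polyEval]
  | cons n l ih => simp [polyEval, ih]

/-- In a ring with `t ^ 4 = 2 u`, `16 = 0` and `8 t = 0`, a polynomial in `t` is evaluated by
combining the reduced powers of `t`. -/
theorem Quad.eval_dot_powers {t : A} {u : Quad} (h : t ^ 4 = 2 * u.eval t) (h16 : (16 : A) = 0)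
    (h8 : 8 * t = 0) (l : List ℕ) :
    ∀ (n : ℕ) (q : Quad), l.length ≤ n →
      (dot l (powers u n q)).eval t = polyEval t l * q.eval t := by
  induction l with
  | nil => intro n q _; simp [dot, polyEval, eval]
  | cons k l ih =>
    rintro (_ | n) q hn
    · simp at hn
    · rw [powers, dot, eval_add, eval_smul, ih n _ (by simpa using hn), eval_reduce h16 h8,
        eval_shift h, polyEval]
      ring

end PolyEval

/-- The coefficients of sixteen polynomials of degree at most `3` in a uniformizer of a totally
ramified extension of `ℚ₂` of degree `4`: modulo the thirteenth power of the uniformizer, every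
integral fourth power is the fourth power of one of them. -/
def residues : List (List ℕ) :=
  [0, 1].flatMap fun i => [0, 1].flatMap fun j => [0, 1].flatMap fun k => [0, 1].map fun l =>
    [i, j, k, l]

/-- The coefficients of the fourth powers of the polynomials in `residues`. -/
def fourthPowers : List (List ℕ) :=
  residues.map fun x => polyMul (polyMul x x) (polyMul x x)

theorem length_sum_fourthPowers : ∀ l ∈ fourthPowers, l.length ≤ 13 ∧ l.sum ≤ 256 := by
  decide +kernel

theorem mem_residues {i j k l : ℕ} (hi : i < 2) (hj : j < 2) (hk : k < 2) (hl : l < 2) :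
    [i, j, k, l] ∈ residues := by
  interval_cases i <;> interval_cases j <;> interval_cases k <;> interval_cases l <;> decide

/-! ### The search for sums of fourth powers -/

/-- The analogue of `Quad.dot` for packed quadruples. -/
noncomputable def packedDot (l : List ℕ) : List ℕ → ℕ :=
  List.rec (fun _ => 0)
    (fun n _ ih ps => List.rec 0 (fun q qs _ => Nat.add (Nat.mul n q) (ih qs)) ps) l

theorem packedDot_map_pack (l : List ℕ) :
    ∀ ps : List Quad, packedDot l (ps.map Quad.pack) = (Quad.dot l ps).pack := by
  induction l with
  | nil => intro ps; rfl
  | cons n l ih =>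
    rintro (_ | ⟨q, ps⟩)
    · rfl
    · rw [Quad.dot, Quad.pack_add, Quad.pack_smul, ← ih ps]
      rfl

/-- Whether a packed quadruple vanishes when `16 = 0` and `8 t = 0`. -/
noncomputable def packedIsZero (n : ℕ) : Bool :=
  Bool.rec false (Nat.beq (n / 2 ^ 16 % 8) 0 && Nat.beq (n / 2 ^ 32 % 8) 0 &&
    Nat.beq (n / 2 ^ 48 % 8) 0) (Nat.beq (Nat.mod n 16) 0)

/-- Whether the sum of `n` and of `g` members of `S`, repetitions allowed, vanishes in the sense
of `packedIsZero`. A sum is searched in the order of the list `S`. The definition applies the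
recursors directly because `decide +kernel` then has little to unfold. -/
noncomputable def packedHits (S : List ℕ) (g : ℕ) : ℕ → Bool :=
  Nat.rec (fun _ n => packedIsZero n)
    (fun _ ih S n =>
      List.rec false (fun x l ih' => Bool.rec ih' true (ih (x :: l) (Nat.add n x))) S)
    g S

theorem packedHits_zero (S : List ℕ) (n : ℕ) : packedHits S 0 n = packedIsZero n := rfl

theorem packedHits_nil (g n : ℕ) : packedHits [] (g + 1) n = false := rfl

theorem packedHits_cons (x : ℕ) (l : List ℕ) (g n : ℕ) :
    packedHits (x :: l) (g + 1) n =
      (packedHits (x :: l) g (n + x) || packedHits l (g + 1) n) := by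
  change Bool.rec (motive := fun _ => Bool) (packedHits l (g + 1) n) true
    (packedHits (x :: l) g (n + x)) = _
  cases packedHits (x :: l) g (n + x) <;> rfl

theorem packedIsZero_pack {q : Quad} (hq : q.Bounded 65535) :
    packedIsZero q.pack = true ↔ 16 ∣ q.a ∧ 8 ∣ q.b ∧ 8 ∣ q.c ∧ 8 ∣ q.d := by
  obtain ⟨a, b, c, d⟩ := q
  obtain ⟨ha, hb, hc, hd⟩ := hq
  dsimp only at ha hb hc hd
  have key : packedIsZero (Quad.pack ⟨a, b, c, d⟩) =
      (Nat.beq (Quad.pack ⟨a, b, c, d⟩ % 16) 0 && (Nat.beq (Quad.pack ⟨a, b, c, d⟩ / 2 ^ 16 % 8) 0 &&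
        Nat.beq (Quad.pack ⟨a, b, c, d⟩ / 2 ^ 32 % 8) 0 &&
        Nat.beq (Quad.pack ⟨a, b, c, d⟩ / 2 ^ 48 % 8) 0)) := by
    change Bool.rec (motive := fun _ => Bool) _ _ (Nat.beq (Quad.pack ⟨a, b, c, d⟩ % 16) 0) = _
    cases Nat.beq (Quad.pack ⟨a, b, c, d⟩ % 16) 0 <;> rfl
  rw [key]
  simp only [Bool.and_eq_true, Nat.beq_eq, Quad.pack]
  omega

/-- The number of fourth powers needed, if it is at most `4`; the argument is the list of packed
fourth powers. -/
noncomputable def packedLevel (S : List ℕ) : ℕ :=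
  bif packedHits S 1 1 then 1 else bif packedHits S 2 1 then 2 else
    bif packedHits S 3 1 then 3 else 4

theorem packedHits_of_lt_packedLevel {S : List ℕ} {g : ℕ} (hg : 0 < g) (h : g < packedLevel S) :
    packedHits S g 1 = false := by
  unfold packedLevel at h
  cases h1 : packedHits S 1 1
  · cases h2 : packedHits S 2 1
    · cases h3 : packedHits S 3 1
      · simp only [h1, h2, h3, cond_false] at h
        interval_cases g <;> assumption
      · simp only [h1, h2, h3, cond_false, cond_true] at h
        interval_cases g <;> assumption
    · simp only [h1, h2, cond_false, cond_true] at h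
      interval_cases g
      assumption
  · simp only [h1, cond_true] at h
    omega

/-- The search `packedHits` is correct: it decides the existence of a multiset with the required
vanishing sum. The bounds ensure that packed additions do not overflow. -/
theorem packedHits_iff {A : Type*} [CommRing A] {t : A}
    (hzero : ∀ q : Quad, q.eval t = 0 ↔ 16 ∣ q.a ∧ 8 ∣ q.b ∧ 8 ∣ q.c ∧ 8 ∣ q.d) (g : ℕ) :
    ∀ (m : ℕ) (L : List Quad) (q : Quad), (∀ x ∈ L, x.Bounded 4000) → q.Bounded (4000 * m) →
      m + g ≤ 16 →
      (packedHits (L.map Quad.pack) g q.pack = true ↔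
        ∃ M : Multiset Quad, M.card = g ∧ (∀ x ∈ M, x ∈ L) ∧
          q.eval t + (M.map (Quad.eval t)).sum = 0) := by
  induction g with
  | zero =>
    intro m L q hL hq hm
    rw [packedHits_zero, packedIsZero_pack (hq.mono (by omega)), ← hzero]
    constructor
    · intro h
      exact ⟨0, by simp [h]⟩
    · rintro ⟨M, hM, -, h⟩
      simpa [Multiset.card_eq_zero.1 hM] using h
  | succ g ih =>
    intro m L q hL hq hm
    induction L with
    | nil =>
      simp only [List.map_nil, packedHits_nil, Bool.false_eq_true, List.not_mem_nil, imp_false,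
        false_iff, not_exists, not_and]
      intro M hM h
      rw [Multiset.eq_zero_of_forall_notMem h] at hM
      simp at hM
    | cons x L ihL =>
      have hx := hL x (by simp)
      have hih := ih (m + 1) (x :: L) (q.add x) hL
        ((hq.add hx).mono (by omega)) (by omega)
      rw [List.map_cons, Quad.pack_add] at hih
      rw [List.map_cons, packedHits_cons, Bool.or_eq_true, hih,
        ihL fun y hy => hL y (by simp [hy])]
      constructor
      · rintro (⟨M, hM, hmem, h⟩ | ⟨M, hM, hmem, h⟩)
        · refine ⟨x ::ₘ M, by simp [hM], ?_, ?_⟩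
          · intro y hy
            rcases Multiset.mem_cons.1 hy with rfl | hy
            · simp
            · exact hmem y hy
          · rw [← h, Quad.eval_add, Multiset.map_cons, Multiset.sum_cons, add_assoc]
        · exact ⟨M, hM, fun y hy => by simp [hmem y hy], h⟩
      · rintro ⟨M, hM, hmem, h⟩
        by_cases hxM : x ∈ M
        · left
          obtain ⟨N, rfl⟩ := Multiset.exists_cons_of_mem hxM
          refine ⟨N, by simpa using hM, fun y hy => hmem y (Multiset.mem_cons_of_mem hy), ?_⟩
          rw [← h, Quad.eval_add, Multiset.map_cons, Multiset.sum_cons, add_assoc]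
        · right
          refine ⟨M, hM, fun y hy => ?_, h⟩
          rcases List.mem_cons.1 (hmem y hy) with rfl | hy'
          · exact absurd hy hxM
          · exact hy'

/-! ### The finite table of fourth levels -/

/-- The dependence of the fourth level `s` on the divisibility properties of a uniformizer `τ`:
`D k l` stands for the divisibility of the polynomial with coefficients `l` at `τ` by `τ ^ k`. The
list `[2, 0, 0, 0, 1]` is `τ ^ 4 + 2`. The levels `5` and `6` are not attained. -/
def LevelTable (D : ℕ → List ℕ → Prop) (s : ℕ) : Prop :=
  (s = 1 ∨ s = 2 ∨ s = 3 ∨ s = 4) ∧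
  D 5 [2, 0, 0, 0, 1] ∧
  (D 5 [2, 0, 0, 0, 1] ∧ ¬D 6 [2, 0, 0, 0, 1] →
    s = 3 ∧ D 13 [4, 0, 0, 4, 0, 0, 2, 0, 1, 0, 0, 0, 1] ∧ ¬D 13 [4, 0, 0, 4, 0, 0, 2, 0, 1] ∧
    ¬D 13 [4, 0, 4, 4, 0, 0, 0, 0, 1] ∧ ¬D 13 [4, 0, 4, 4, 0, 0, 0, 0, 1, 0, 0, 0, 1]) ∧
  (D 6 [2, 0, 0, 0, 1] ∧ ¬D 7 [2, 0, 0, 0, 1] →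
    (s = 1 ∨ s = 2 ∨ s = 3) ∧
    (s = 1 ↔ D 13 [2, 4, 6, 4, 1] ∨ D 13 [2, 4, 2, 0, 3, 0, 2, 0, 1] ∨ D 13 [2, 4, 2, 0, 1] ∨
      D 13 [2, 4, 6, 4, 3, 0, 2, 0, 1]) ∧
    (s = 2 ↔
      ((D 12 [2, 4, 6, 4, 1] ∧ ¬D 13 [2, 4, 6, 4, 1]) ∨
        (D 12 [2, 4, 2, 0, 3, 0, 2, 0, 1] ∧ ¬D 13 [2, 4, 2, 0, 3, 0, 2, 0, 1]) ∨
        (D 12 [2, 4, 2, 0, 1] ∧ ¬D 13 [2, 4, 2, 0, 1]) ∨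
        (D 12 [2, 4, 6, 4, 3, 0, 2, 0, 1] ∧ ¬D 13 [2, 4, 6, 4, 3, 0, 2, 0, 1])) ∨
      (D 12 [2, 4, 6, 4, 1, 0, 0, 0, 1] ∨ D 12 [2, 4, 2, 0, 3, 0, 2, 0, 2] ∨
        D 12 [2, 4, 2, 0, 1, 0, 0, 0, 1] ∨ D 12 [2, 4, 6, 4, 3, 0, 2, 0, 2]))) ∧
  (D 7 [2, 0, 0, 0, 1] ∧ ¬D 8 [2, 0, 0, 0, 1] →
    (s = 3 ∨ s = 4) ∧ (s = 3 ↔ D 13 [4, 0, 0, 4, 2, 0, 0, 0, 0, 0, 0, 0, 1])) ∧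
  (D 8 [2, 0, 0, 0, 1] ∧ ¬D 9 [2, 0, 0, 0, 1] →
    (s = 2 ∨ s = 3 ∨ s = 4) ∧
    (s = 2 ↔ D 13 [2, 0, 0, 0, 1, 0, 0, 0, 1] ∨ D 13 [2, 0, 4, 0, 1, 0, 0, 0, 1] ∨
      D 13 [2, 0, 0, 4, 1, 0, 0, 0, 1, 0, 0, 0, 1] ∨
      D 13 [2, 0, 4, 4, 1, 0, 0, 0, 1, 0, 0, 0, 1]) ∧
    (s = 3 ↔ D 13 [2, 0, 0, 0, 1, 0, 0, 0, 1, 0, 0, 0, 1] ∨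
      D 13 [2, 0, 4, 0, 1, 0, 0, 0, 1, 0, 0, 0, 1] ∨
      D 13 [2, 0, 0, 4, 1, 0, 0, 0, 1] ∨ D 13 [2, 0, 4, 4, 1, 0, 0, 0, 1]) ∧
    (s = 4 ↔ D 9 [2, 0, 0, 0, 1, 0, 0, 0, 1] ∧ ¬D 10 [2, 0, 0, 0, 1, 0, 0, 0, 1])) ∧
  (D 9 [2, 0, 0, 0, 1] ∧ ¬D 10 [2, 0, 0, 0, 1] → s = 4) ∧
  (D 10 [2, 0, 0, 0, 1] ∧ ¬D 11 [2, 0, 0, 0, 1] →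
    (s = 2 ∨ s = 3) ∧
    (s = 2 ↔ D 13 [2, 0, 4, 4, 1, 0, 0, 0, 0, 0, 0, 0, 1] ∨
      D 13 [2, 0, 4, 0, 1, 0, 0, 0, 0, 0, 0, 0, 1])) ∧
  (D 11 [2, 0, 0, 0, 1] ∧ ¬D 12 [2, 0, 0, 0, 1] →
    (s = 2 ∨ s = 3) ∧ (s = 2 ↔ D 13 [2, 0, 0, 4, 1])) ∧
  (D 12 [2, 0, 0, 0, 1] ∧ ¬D 13 [2, 0, 0, 0, 1] → s = 3) ∧
  (D 13 [2, 0, 0, 0, 1] → s = 2)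

set_option synthInstance.maxSize 2000 in
set_option synthInstance.maxHeartbeats 400000 in
instance (D : ℕ → List ℕ → Prop) [∀ k l, Decidable (D k l)] (s : ℕ) :
    Decidable (LevelTable D s) := by
  unfold LevelTable; infer_instance

/-- The packed reduced forms of `t ^ 0, …, t ^ 12` when `t ^ 4 = 2 u`. -/
noncomputable def packedPowers (u : Quad) : List ℕ := (u.powers 13 ⟨1, 0, 0, 0⟩).map Quad.pack

/-- The table is correct when `t ^ 4 = 2 u`. -/
noncomputable def tableHolds (u : Quad) : Bool :=
  let ps := packedPowers u
  let S := fourthPowers.map (packedDot · ps)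
  packedHits S (packedLevel S) 1 &&
    decide (LevelTable (fun k l => (Quad.unpack (packedDot l ps)).divides k = true) (packedLevel S))

set_option maxRecDepth 10000 in
theorem tableHolds_all :
    ((List.range 4).all fun i => (List.range 4).all fun j => (List.range 4).all fun k =>
      (List.range 4).all fun l => tableHolds ⟨2 * i + 1, j, k, l⟩) = true := by
  decide +kernel

theorem tableHolds_of_odd {u : Quad} (ha : u.a % 2 = 1) (ha' : u.a < 8) (hb : u.b < 4)
    (hc : u.c < 4) (hd : u.d < 4) : tableHolds u = true := by
  have h := tableHolds_all
  simp only [List.all_eq_true, List.mem_range] at h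
  have h' := h (u.a / 2) (by omega) u.b hb u.c hc u.d hd
  rwa [show 2 * (u.a / 2) + 1 = u.a by omega] at h'

/-! ### Congruences in a totally ramified ring of degree four -/

theorem LevelTable.congr {D D' : ℕ → List ℕ → Prop} {s : ℕ}
    (h : ∀ k ≤ 13, ∀ l : List ℕ, l.length ≤ 13 → l.sum ≤ 30 → (D k l ↔ D' k l))
    (hD : LevelTable D s) : LevelTable D' s := by
  unfold LevelTable at hD ⊢
  simpa [h] using hD

/-- Reducing the coefficients of a quadruple modulo `m` and `n` changes its value by a
multiple of `τ ^ k`, for suitable `k`. -/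
theorem Quad.dvd_eval_sub_eval_mod {R : Type*} [CommRing R] {τ : R} {m n k : ℕ}
    (hm : τ ^ k ∣ (m : R)) (hn : τ ^ k ∣ n * τ) (q : Quad) :
    τ ^ k ∣ q.eval τ - Quad.eval τ ⟨q.a % m, q.b % n, q.c % n, q.d % n⟩ := by
  have key (r s : ℕ) : (r : R) = s * (r / s : ℕ) + (r % s : ℕ) := by
    rw [← Nat.cast_mul, ← Nat.cast_add, Nat.div_add_mod]
  have e : q.eval τ - Quad.eval τ ⟨q.a % m, q.b % n, q.c % n, q.d % n⟩ =
      m * (q.a / m : ℕ) + n * τ * ((q.b / n : ℕ) + (q.c / n : ℕ) * τ + (q.d / n : ℕ) * τ ^ 2) := by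
    simp only [Quad.eval]
    linear_combination key q.a m + τ * key q.b n + τ ^ 2 * key q.c n + τ ^ 3 * key q.d n
  rw [e]
  exact dvd_add (hm.mul_right _) (hn.mul_right _)

/-- The properties of a uniformizer `τ` of a discrete valuation ring with residue field of two
elements in which `2` has valuation `4`. -/
structure IsDyadicUniformizer {R : Type*} [CommRing R] (τ : R) : Prop where
  ne_zero : τ ≠ 0
  not_isUnit : ¬IsUnit τ
  residue (x : R) : τ ∣ x ∨ τ ∣ x - 1
  pow_four : ∃ w, IsUnit w ∧ τ ^ 4 = 2 * w

namespace IsDyadicUniformizer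

variable {R : Type*} [CommRing R] {τ : R} (h : IsDyadicUniformizer τ)
include h

theorem exists_two_eq : ∃ v, IsUnit v ∧ 2 = τ ^ 4 * v := by
  obtain ⟨_, ⟨w, rfl⟩, hw⟩ := h.pow_four
  exact ⟨↑w⁻¹, w⁻¹.isUnit, by rw [hw, mul_assoc, w.mul_inv, mul_one]⟩

theorem dvd_two : τ ∣ 2 := by
  obtain ⟨v, -, hv⟩ := h.exists_two_eq
  exact ⟨τ ^ 3 * v, by linear_combination hv⟩

theorem dvd_natCast (n : ℕ) : τ ∣ (n : R) ↔ n % 2 = 0 := by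
  have h2 : (n : R) = 2 * (n / 2 : ℕ) + (n % 2 : ℕ) := by
    rw [← Nat.cast_ofNat (R := R) (n := 2), ← Nat.cast_mul, ← Nat.cast_add, Nat.div_add_mod]
  rw [h2, dvd_add_right (h.dvd_two.mul_right _)]
  rcases Nat.mod_two_eq_zero_or_one n with h0 | h0
  · simp [h0]
  · simpa [h0] using fun h1 => h.not_isUnit (isUnit_of_dvd_one h1)

theorem dvd_eval (q : Quad) : τ ∣ q.eval τ ↔ q.a % 2 = 0 := by
  rw [← h.dvd_natCast, Quad.eval, add_assoc, add_assoc]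
  exact dvd_add_left ⟨q.b + q.c * τ + q.d * τ ^ 2, by ring⟩

/-- Splitting off the constant coefficient: `n + τ y` is divisible by `τ ^ (j + 1)` only if `n` is
even, and then `n = τ ^ 4 v (n / 2)` with `2 = τ ^ 4 v` can be divided by `τ`. -/
theorem pow_succ_dvd_iff [IsDomain R] {v : R} (hv : 2 = τ ^ 4 * v) (j n : ℕ) (y : R) :
    τ ^ (j + 1) ∣ n + τ * y ↔ n % 2 = 0 ∧ τ ^ j ∣ y + τ ^ 3 * (v * (n / 2 : ℕ)) := by
  have hn : τ ∣ n + τ * y ↔ n % 2 = 0 := by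
    rw [← h.dvd_natCast]
    exact dvd_add_left (Dvd.intro _ rfl)
  have key (h0 : n % 2 = 0) : n + τ * y = τ * (y + τ ^ 3 * (v * (n / 2 : ℕ))) := by
    have h2 : (n : R) = 2 * (n / 2 : ℕ) := by
      rw [← Nat.cast_ofNat (R := R) (n := 2), ← Nat.cast_mul,
        Nat.mul_div_cancel' (Nat.dvd_of_mod_eq_zero h0)]
    linear_combination h2 + ((n / 2 : ℕ) : R) * hv
  constructor
  · intro hd
    have h0 := hn.1 ((dvd_pow_self τ (Nat.succ_ne_zero j)).trans hd)
    rw [key h0, pow_succ', mul_dvd_mul_iff_left h.ne_zero] at hd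
    exact ⟨h0, hd⟩
  · rintro ⟨h0, hd⟩
    rw [key h0, pow_succ']
    exact mul_dvd_mul_left τ hd

theorem divides_iff [IsDomain R] (k : ℕ) (q : Quad) :
    q.divides k = true ↔ τ ^ k ∣ q.eval τ := by
  obtain ⟨v, hu, hv⟩ := h.exists_two_eq
  have e0 (q : Quad) : q.eval τ = q.a + τ * (q.b + q.c * τ + q.d * τ ^ 2) := by
    rw [Quad.eval]; ring
  have e1 (q : Quad) : q.b + q.c * τ + q.d * τ ^ 2 + τ ^ 3 * (v * (q.a / 2 : ℕ)) =
      q.b + τ * (q.c + q.d * τ + τ ^ 2 * (v * (q.a / 2 : ℕ))) := by ring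
  have e2 (q : Quad) : q.c + q.d * τ + τ ^ 2 * (v * (q.a / 2 : ℕ)) + τ ^ 3 * (v * (q.b / 2 : ℕ)) =
      q.c + τ * (q.d + τ * (v * (q.a / 2 : ℕ)) + τ ^ 2 * (v * (q.b / 2 : ℕ))) := by ring
  have e3 (q : Quad) : q.d + τ * (v * (q.a / 2 : ℕ)) + τ ^ 2 * (v * (q.b / 2 : ℕ)) +
      τ ^ 3 * (v * (q.c / 2 : ℕ)) =
      q.d + τ * (v * (q.a / 2 : ℕ) + τ * (v * (q.b / 2 : ℕ)) + τ ^ 2 * (v * (q.c / 2 : ℕ))) := by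
    ring
  have e4 (q : Quad) : v * (q.a / 2 : ℕ) + τ * (v * (q.b / 2 : ℕ)) + τ ^ 2 * (v * (q.c / 2 : ℕ)) +
      τ ^ 3 * (v * (q.d / 2 : ℕ)) =
      v * Quad.eval τ ⟨q.a / 2, q.b / 2, q.c / 2, q.d / 2⟩ := by
    rw [Quad.eval]; ring
  induction k, q using Quad.divides.induct with
  | case1 q => simp [Quad.divides]
  | case2 q =>
    rw [e0, h.pow_succ_dvd_iff hv 0]
    simp [Quad.divides]
  | case3 q =>
    rw [e0, h.pow_succ_dvd_iff hv 1, e1, h.pow_succ_dvd_iff hv 0]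
    simp [Quad.divides]
  | case4 q =>
    rw [e0, h.pow_succ_dvd_iff hv 2, e1, h.pow_succ_dvd_iff hv 1, e2, h.pow_succ_dvd_iff hv 0]
    simp [Quad.divides, and_assoc]
  | case5 k q ih =>
    rw [e0, h.pow_succ_dvd_iff hv (k + 3), e1, h.pow_succ_dvd_iff hv (k + 2), e2,
      h.pow_succ_dvd_iff hv (k + 1), e3, h.pow_succ_dvd_iff hv k, e4, hu.dvd_mul_left, ← propext ih]
    simp [Quad.divides, and_assoc]

/-- Every element is congruent to a combination of `1, τ, τ ^ 2, τ ^ 3` with natural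
coefficients. -/
theorem exists_dvd_sub_eval (k : ℕ) : ∀ x : R, ∃ q : Quad, τ ^ (4 * k) ∣ x - q.eval τ := by
  obtain ⟨w, -, hw⟩ := h.pow_four
  have digit (x : R) : ∃ (n : ℕ) (y : R), x = n + τ * y := by
    rcases h.residue x with ⟨y, hy⟩ | ⟨y, hy⟩
    · exact ⟨0, y, by simpa using hy⟩
    · exact ⟨1, y, by rw [← hy]; simp⟩
  induction k with
  | zero => exact fun x => ⟨⟨0, 0, 0, 0⟩, by simp⟩
  | succ k ih =>
    intro x
    obtain ⟨a, x1, rfl⟩ := digit x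
    obtain ⟨b, x2, rfl⟩ := digit x1
    obtain ⟨c, x3, rfl⟩ := digit x2
    obtain ⟨d, x4, rfl⟩ := digit x3
    obtain ⟨q, z, hz⟩ := ih (w * x4)
    refine ⟨⟨a + 2 * q.a, b + 2 * q.b, c + 2 * q.c, d + 2 * q.d⟩, ?_⟩
    obtain ⟨v, -, hv⟩ := h.exists_two_eq
    refine ⟨v * z, ?_⟩
    simp only [Quad.eval] at hz ⊢
    push_cast
    linear_combination x4 * hw + 2 * hz + τ ^ (4 * k) * z * hv

/-- Modulo `τ ^ 13`, fourth powers are represented by the fourth powers of `residues`. For a unit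
the fourth power depends only on the residue modulo `τ ^ 5` and up to sign, for a non-unit only on
the residue modulo `τ ^ 4`. -/
theorem exists_residue (x : R) :
    ∃ l ∈ residues, τ ^ 13 ∣ x ^ 4 - polyEval τ l ^ 4 := by
  obtain ⟨v, -, hv⟩ := h.exists_two_eq
  have h4 : (4 : R) = τ ^ 8 * v ^ 2 := by linear_combination (2 + τ ^ 4 * v) * hv
  have reduce (x : R) : ∃ q : Quad, q.a < 4 ∧ q.b < 2 ∧ q.c < 2 ∧ q.d < 2 ∧
      τ ^ 5 ∣ x - q.eval τ := by
    obtain ⟨q, hq⟩ := h.exists_dvd_sub_eval 2 x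
    refine ⟨⟨q.a % 4, q.b % 2, q.c % 2, q.d % 2⟩, Nat.mod_lt _ (by norm_num),
      Nat.mod_lt _ (by norm_num), Nat.mod_lt _ (by norm_num), Nat.mod_lt _ (by norm_num), ?_⟩
    have h1 : τ ^ 5 ∣ ((4 : ℕ) : R) := ⟨τ ^ 3 * v ^ 2, by push_cast; linear_combination h4⟩
    have h2 : τ ^ 5 ∣ ((2 : ℕ) : R) * τ := ⟨v, by push_cast; linear_combination τ * hv⟩
    have := dvd_add ((pow_dvd_pow τ (by norm_num)).trans hq) (Quad.dvd_eval_sub_eval_mod h1 h2 q)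
    rwa [sub_add_sub_cancel] at this
  have unit (x y : R) (hxy : τ ^ 5 ∣ x - y) : τ ^ 13 ∣ x ^ 4 - y ^ 4 := by
    obtain ⟨z, hz⟩ := hxy
    obtain rfl : x = y + τ ^ 5 * z := by linear_combination hz
    refine ⟨v ^ 2 * z * y ^ 3 + 3 * τ * v * y ^ 2 * z ^ 2 + τ ^ 10 * v ^ 2 * y * z ^ 3 +
      τ ^ 7 * z ^ 4, ?_⟩
    linear_combination (τ ^ 5 * y ^ 3 * z + τ ^ 15 * y * z ^ 3) * h4 +
      3 * τ ^ 10 * y ^ 2 * z ^ 2 * hv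
  have nonunit (x y : R) (hy : τ ∣ y) (hxy : τ ^ 4 ∣ x - y) : τ ^ 13 ∣ x ^ 4 - y ^ 4 := by
    obtain ⟨z, hz⟩ := hxy
    obtain ⟨y, rfl⟩ := hy
    obtain rfl : x = τ * y + τ ^ 4 * z := by linear_combination hz
    refine ⟨τ ^ 2 * v ^ 2 * z * y ^ 3 + 3 * τ * v * y ^ 2 * z ^ 2 + τ ^ 8 * v ^ 2 * y * z ^ 3 +
      τ ^ 3 * z ^ 4, ?_⟩
    linear_combination (τ ^ 7 * y ^ 3 * z + τ ^ 13 * y * z ^ 3) * h4 +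
      3 * τ ^ 10 * y ^ 2 * z ^ 2 * hv
  have even (b c d : ℕ) : τ ∣ polyEval τ [0, b, c, d] :=
    ⟨b + τ * (c + τ * d), by simp [polyEval]⟩
  obtain ⟨q, ha, hb, hc, hd, hq⟩ := reduce x
  obtain ⟨a, b, c, d⟩ := q
  dsimp only at ha hb hc hd
  obtain ⟨z, hz⟩ := hq
  simp only [Quad.eval] at hz
  interval_cases a
  · refine ⟨[0, b, c, d], mem_residues (by norm_num) hb hc hd, nonunit _ _ (even b c d)
      ⟨τ * z, ?_⟩⟩
    simp only [polyEval]; push_cast at hz ⊢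
    linear_combination hz
  · refine ⟨[1, b, c, d], mem_residues (by norm_num) hb hc hd, unit _ _ ⟨z, ?_⟩⟩
    simp only [polyEval]; push_cast at hz ⊢
    linear_combination hz
  · refine ⟨[0, b, c, d], mem_residues (by norm_num) hb hc hd, nonunit _ _ (even b c d)
      ⟨τ * z + v, ?_⟩⟩
    simp only [polyEval]; push_cast at hz ⊢
    linear_combination hz + hv
  · refine ⟨[1, b, c, d], mem_residues (by norm_num) hb hc hd, ?_⟩
    rw [← Even.neg_pow (by decide : Even 4) x]
    refine unit _ _ ⟨-z - τ ^ 3 * v ^ 2 - v * (b + c * τ + d * τ ^ 2), ?_⟩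
    simp only [polyEval]; push_cast at hz ⊢
    linear_combination -hz - h4 - (b * τ + c * τ ^ 2 + d * τ ^ 3 : R) * hv

/-- The fourth power of the uniformizer is `2 u` modulo `τ ^ 13`, with `u` one of the quadruples for
which the table has been checked. -/
theorem exists_quad : ∃ u : Quad, tableHolds u = true ∧ τ ^ 13 ∣ τ ^ 4 - 2 * u.eval τ := by
  obtain ⟨v, -, hv⟩ := h.exists_two_eq
  obtain ⟨w, hu, hw⟩ := h.pow_four
  obtain ⟨q, hq⟩ := h.exists_dvd_sub_eval 3 w
  have h1 : τ ^ 9 ∣ ((8 : ℕ) : R) := ⟨τ ^ 3 * v ^ 3, by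
    push_cast; linear_combination (4 + 2 * τ ^ 4 * v + τ ^ 8 * v ^ 2) * hv⟩
  have h2 : τ ^ 9 ∣ ((4 : ℕ) : R) * τ := ⟨v ^ 2, by
    push_cast; linear_combination τ * (2 + τ ^ 4 * v) * hv⟩
  have hd := dvd_add ((pow_dvd_pow τ (by norm_num)).trans hq) (Quad.dvd_eval_sub_eval_mod h1 h2 q)
  rw [sub_add_sub_cancel] at hd
  refine ⟨⟨q.a % 8, q.b % 4, q.c % 4, q.d % 4⟩, ?_, ?_⟩
  · apply tableHolds_of_odd
    · by_contra ha
      have hτ : τ ∣ w - Quad.eval τ ⟨q.a % 8, q.b % 4, q.c % 4, q.d % 4⟩ :=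
        (dvd_pow_self τ (by norm_num)).trans hd
      rw [dvd_sub_left ((h.dvd_eval _).2 (by dsimp only at ha ⊢; omega))] at hτ
      exact h.not_isUnit (isUnit_of_dvd_unit hτ hu)
    all_goals exact Nat.mod_lt _ (by norm_num)
  · obtain ⟨z, hz⟩ := hd
    exact ⟨v * z, by linear_combination hw + 2 * hz + τ ^ 9 * z * hv⟩

end IsDyadicUniformizer

/-! ### The level modulo the thirteenth power of the uniformizer -/

namespace IsDyadicUniformizer

variable {R : Type*} [CommRing R] [IsDomain R] {τ : R} (h : IsDyadicUniformizer τ)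
include h

theorem mk_eval_eq_zero_iff (q : Quad) :
    q.eval (Ideal.Quotient.mk (Ideal.span {τ ^ 13}) τ) = 0 ↔
      16 ∣ q.a ∧ 8 ∣ q.b ∧ 8 ∣ q.c ∧ 8 ∣ q.d := by
  have he : q.eval (Ideal.Quotient.mk (Ideal.span {τ ^ 13}) τ) =
      Ideal.Quotient.mk (Ideal.span {τ ^ 13}) (q.eval τ) := by
    simp [Quad.eval]
  rw [he, Ideal.Quotient.eq_zero_iff_mem, Ideal.mem_span_singleton, ← h.divides_iff]
  simp only [Quad.divides, Bool.and_eq_true, Nat.beq_eq]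
  omega

/-- The number of fourth powers needed to represent `-1` modulo `τ ^ 13` is given by the table. -/
theorem exists_level :
    ∃ s : ℕ, LevelTable (fun k l => τ ^ k ∣ polyEval τ l) s ∧
      (∃ x : Fin s → R, τ ^ 13 ∣ 1 + ∑ i, x i ^ 4) ∧
      ∀ g, 0 < g → g < s → ¬∃ x : Fin g → R, τ ^ 13 ∣ 1 + ∑ i, x i ^ 4 := by
  obtain ⟨u, hu, hτu⟩ := h.exists_quad
  set π := Ideal.Quotient.mk (Ideal.span {τ ^ 13}) with hπ
  have hmk (x : R) : π x = 0 ↔ τ ^ 13 ∣ x := by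
    rw [hπ, Ideal.Quotient.eq_zero_iff_mem, Ideal.mem_span_singleton]
  have hpoly (l : List ℕ) : π (polyEval τ l) = polyEval (π τ) l := map_polyEval τ π l
  have heval (q : Quad) : π (q.eval τ) = q.eval (π τ) := by simp [Quad.eval]
  have hrel : π τ ^ 4 = 2 * u.eval (π τ) := by
    rw [← sub_eq_zero, ← heval, ← map_pow, ← map_ofNat π 2, ← map_mul, ← map_sub, hmk]
    exact hτu
  have h16 : (16 : R ⧸ Ideal.span {τ ^ 13}) = 0 := by
    simpa [Quad.eval] using (h.mk_eval_eq_zero_iff ⟨16, 0, 0, 0⟩).2 (by simp)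
  have h8 : 8 * π τ = 0 := by
    simpa [Quad.eval] using (h.mk_eval_eq_zero_iff ⟨0, 8, 0, 0⟩).2 (by simp)
  set ps := u.powers 13 ⟨1, 0, 0, 0⟩ with hps
  have hdot (l : List ℕ) (hl : l.length ≤ 13) : (Quad.dot l ps).eval (π τ) = polyEval (π τ) l := by
    rw [hps, Quad.eval_dot_powers hrel h16 h8 l 13 _ hl]
    simp [Quad.eval]
  have hbound : ∀ p ∈ ps, p.Bounded 15 := u.bounded_powers 13 _ (by simp [Quad.Bounded])
  set L := fourthPowers.map fun l => Quad.dot l ps with hL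
  have hS : fourthPowers.map (packedDot · (packedPowers u)) = L.map Quad.pack := by
    rw [hL, List.map_map]
    exact List.map_congr_left fun l _ => packedDot_map_pack l ps
  have hLbound : ∀ x ∈ L, x.Bounded 4000 := by
    intro x hx
    obtain ⟨l, hl, rfl⟩ := List.mem_map.1 hx
    exact (Quad.bounded_dot l ps hbound).mono (by have := (length_sum_fourthPowers l hl).2; omega)
  have hfourth (l : List ℕ) (hl : l ∈ residues) :
      Quad.dot (polyMul (polyMul l l) (polyMul l l)) ps ∈ L ∧
        (Quad.dot (polyMul (polyMul l l) (polyMul l l)) ps).eval (π τ) =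
          π (polyEval τ l ^ 4) := by
    have hmem : polyMul (polyMul l l) (polyMul l l) ∈ fourthPowers :=
      List.mem_map.2 ⟨l, hl, rfl⟩
    refine ⟨List.mem_map.2 ⟨_, hmem, rfl⟩, ?_⟩
    rw [hdot _ (length_sum_fourthPowers _ hmem).1, polyEval_polyMul, polyEval_polyMul, map_pow,
      hpoly]
    ring
  have hto (x : R) : ∃ q ∈ L, q.eval (π τ) = π (x ^ 4) := by
    obtain ⟨l, hl, hx⟩ := h.exists_residue x
    refine ⟨_, (hfourth l hl).1, ?_⟩
    rw [(hfourth l hl).2, eq_comm, ← sub_eq_zero, ← map_sub, hmk]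
    exact hx
  have hfrom (q : Quad) (hq : q ∈ L) : ∃ x : R, π (x ^ 4) = q.eval (π τ) := by
    obtain ⟨f, hf, rfl⟩ := List.mem_map.1 hq
    obtain ⟨l, hl, rfl⟩ := List.mem_map.1 hf
    exact ⟨_, (hfourth l hl).2.symm⟩
  have hhits (g : ℕ) (hg : g ≤ 15) : packedHits (L.map Quad.pack) g 1 = true ↔
      ∃ x : Fin g → R, τ ^ 13 ∣ 1 + ∑ i, x i ^ 4 := by
    have := packedHits_iff h.mk_eval_eq_zero_iff g 1 L ⟨1, 0, 0, 0⟩ hLbound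
      (by simp [Quad.Bounded]) (by omega)
    rw [show Quad.pack ⟨1, 0, 0, 0⟩ = 1 from rfl, ← hπ] at this
    rw [this, show Quad.eval (π τ) ⟨1, 0, 0, 0⟩ = 1 by simp [Quad.eval]]
    constructor
    · rintro ⟨M, hM, hmem, hsum⟩
      induction M using Quotient.inductionOn with
      | h M =>
        simp only [Multiset.quot_mk_to_coe, Multiset.coe_card, Multiset.mem_coe, Multiset.map_coe,
          Multiset.sum_coe] at hM hmem hsum
        subst hM
        choose! f hf using hfrom
        refine ⟨fun i => f M[i], ?_⟩
        rw [← hmk, map_add, map_one, map_sum, ← hsum, ← Fin.sum_univ_fun_getElem]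
        simp only [Fin.getElem_fin, add_right_inj]
        exact Finset.sum_congr rfl fun i _ => hf _ (hmem _ (List.getElem_mem _))
    · rintro ⟨x, hx⟩
      choose f hf hf' using hto
      refine ⟨Finset.univ.val.map fun i => f (x i), by simp, ?_, ?_⟩
      · intro q hq
        obtain ⟨i, -, rfl⟩ := Multiset.mem_map.1 hq
        exact hf _
      · rw [Multiset.map_map]
        simp only [Function.comp_apply, hf']
        rw [← hmk, map_add, map_one, map_sum] at hx
        exact hx
  simp only [tableHolds, Bool.and_eq_true, decide_eq_true_eq] at hu
  rw [hS] at hu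
  refine ⟨packedLevel (L.map Quad.pack), hu.2.congr ?_, ?_, ?_⟩
  · intro k hk l hl hsum
    have hb : (Quad.dot l ps).Bounded 65535 := (Quad.bounded_dot l ps hbound).mono (by omega)
    rw [packedPowers, packedDot_map_pack, ← hps, Quad.unpack_pack hb, h.divides_iff]
    have hd : τ ^ k ∣ (Quad.dot l ps).eval τ - polyEval τ l := by
      refine (pow_dvd_pow τ hk).trans ((hmk _).1 ?_)
      rw [map_sub, heval, hdot l hl, hpoly, sub_self]
    exact dvd_iff_dvd_of_dvd_sub hd
  · refine (hhits _ ?_).1 hu.1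
    rcases hu.2.1 with e | e | e | e <;> rw [e] <;> norm_num
  · intro g hg hgs
    rw [← hhits g (by rcases hu.2.1 with e | e | e | e <;> omega)]
    rw [packedHits_of_lt_packedLevel hg hgs]
    exact Bool.false_ne_true

end IsDyadicUniformizer

/-! ### Lifting congruences to the complete ring -/

namespace IsDyadicUniformizer

variable {R : Type*} [CommRing R] {τ : R} (h : IsDyadicUniformizer τ)
include h

open Polynomial in
/-- In a Henselian ring every element congruent to `1` modulo `τ ^ 13` is a fourth power: writing it
as `1 + 4 ρ` with `ρ` divisible by `τ ^ 5`, and the root as `1 + ρ / y`, one obtains a quartic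
equation for `y` that reduces to `y ^ 4 = y ^ 3` modulo `τ`. -/
theorem exists_pow_four_eq [HenselianRing R (Ideal.span {τ})] {r : R} (hr : τ ^ 13 ∣ r) :
    ∃ y : R, y ^ 4 = 1 + r := by
  obtain ⟨w, -, hw⟩ := h.pow_four
  obtain ⟨ρ, rfl⟩ := hr
  set σ := w ^ 2 * ρ with hσ
  set a := 3 * w * σ with ha
  set b := τ ^ 9 * σ ^ 2 with hb
  set c := τ ^ 6 * w ^ 2 * σ ^ 3 with hc
  set f : R[X] := X ^ 4 + (-X ^ 3 - C (τ * a) * X ^ 2 - C (τ * b) * X - C (τ * c)) with hf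
  have hmonic : f.Monic := by
    apply monic_X_pow_add
    compute_degree!
  have hmem (x : R) : τ * x ∈ Ideal.span {τ} :=
    Ideal.mul_mem_right _ _ (Ideal.mem_span_singleton_self τ)
  have h0 : f.eval 1 ∈ Ideal.span {τ} := by
    have : f.eval 1 = τ * (-a - b - c) := by
      simp only [hf, eval_add, eval_sub, eval_neg, eval_mul, eval_pow, eval_X, eval_C]
      ring
    rw [this]
    exact hmem _
  have h1 : IsUnit (Ideal.Quotient.mk (Ideal.span {τ}) (f.derivative.eval 1)) := by
    have : f.derivative.eval 1 = 1 + τ * (-2 * a - b) := by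
      simp only [hf, derivative_add, derivative_sub, derivative_neg, derivative_C_mul,
        derivative_X_pow, derivative_X, derivative_C, eval_add, eval_sub, eval_neg, eval_mul,
        eval_pow, eval_X, eval_C, eval_one, eval_zero, map_natCast, eval_natCast]
      push_cast
      ring
    rw [this, map_add, Ideal.Quotient.eq_zero_iff_mem.2 (hmem _), map_one, add_zero]
    exact isUnit_one
  obtain ⟨y, hy, hy1⟩ := HenselianRing.is_henselian f hmonic 1 h0 h1
  obtain ⟨y, rfl⟩ : IsUnit y := by
    have := Ideal.mem_jacobson_bot.1 (HenselianRing.jac hy1) 1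
    simpa using this
  have hroot : (y : R) ^ 4 - y ^ 3 - τ * a * y ^ 2 - τ * b * y - τ * c = 0 := by
    have := hy.eq_zero
    simp only [hf, eval_add, eval_sub, eval_neg, eval_mul, eval_pow, eval_X, eval_C] at this
    linear_combination this
  refine ⟨1 + τ ^ 5 * σ * ↑y⁻¹, ?_⟩
  have hinv : (y : R) * ↑y⁻¹ = 1 := y.mul_inv
  set z : R := ↑y⁻¹
  have hz : 1 - z - τ * a * z ^ 2 - τ * b * z ^ 3 - τ * c * z ^ 4 = 0 := by
    have hpow (n : ℕ) : (y : R) ^ n * z ^ n = 1 := by rw [← mul_pow, hinv, one_pow]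
    linear_combination z ^ 4 * hroot - hpow 4 + z * hpow 3 + τ * a * z ^ 2 * hpow 2 +
      τ * b * z ^ 3 * hinv
  rw [ha, hb, hc] at hz
  linear_combination (-4 * τ ^ 5 * σ) * hz + (6 * τ ^ 6 * σ ^ 2 * z ^ 2 +
    (τ ^ 4 + 2 * w) * (τ ^ 12 * σ ^ 4 * z ^ 4 - τ ^ 5 * ρ)) * hw + 4 * τ ^ 5 * hσ

/-- A representation of `-1` modulo `τ ^ 13` as a sum of fourth powers can be corrected to an exact
one, since one of the summands is a unit. -/
theorem exists_sum_eq_neg_one [HenselianRing R (Ideal.span {τ})] [IsLocalRing R] {g : ℕ}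
    (x : Fin g → R) (hx : τ ^ 13 ∣ 1 + ∑ i, x i ^ 4) : ∃ y : Fin g → R, ∑ i, y i ^ 4 = -1 := by
  obtain ⟨j, hj⟩ : ∃ j, ¬τ ∣ x j := by
    by_contra! hall
    have h1 : τ ∣ ∑ i, x i ^ 4 :=
      Finset.dvd_sum fun i _ => (hall i).trans (dvd_pow_self (x i) (by norm_num : 4 ≠ 0))
    exact h.not_isUnit (isUnit_of_dvd_one
      ((dvd_add_left h1).1 ((dvd_pow_self τ (by norm_num : 13 ≠ 0)).trans hx)))
  obtain ⟨c, hc⟩ : IsUnit (x j) := by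
    rcases h.residue (x j) with hd | hd
    · exact absurd hd hj
    · by_contra hu
      refine (IsLocalRing.mem_maximalIdeal (1 : R)).1 ?_ isUnit_one
      have := Ideal.sub_mem _ ((IsLocalRing.mem_maximalIdeal _).2 hu)
        (Ideal.mem_of_dvd _ hd ((IsLocalRing.mem_maximalIdeal τ).2 h.not_isUnit))
      rwa [sub_sub_cancel] at this
  obtain ⟨z, hz⟩ := h.exists_pow_four_eq (dvd_neg.2 (hx.mul_left ((↑c⁻¹ : R) ^ 4)))
  refine ⟨Function.update x j (c * z), ?_⟩
  have hinv : (c : R) ^ 4 * (↑c⁻¹ : R) ^ 4 = 1 := by rw [← mul_pow, c.mul_inv, one_pow]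
  have h1 := Finset.add_sum_erase Finset.univ (fun i => x i ^ 4) (Finset.mem_univ j)
  rw [← Finset.add_sum_erase _ _ (Finset.mem_univ j), Function.update_self,
    Finset.sum_congr rfl fun i hi => by rw [Function.update_of_ne (Finset.ne_of_mem_erase hi)]]
  rw [← hc] at h1
  linear_combination (c : R) ^ 4 * hz - (1 + ∑ i, x i ^ 4) * hinv + h1

end IsDyadicUniformizer

theorem fourthLevel_eq {F : Type*} [Field F] {s : ℕ} (hs : 0 < s)
    (hx : ∃ x : Fin s → F, ∑ i, x i ^ 4 = -1)
    (hmin : ∀ g, 0 < g → g < s → ¬∃ x : Fin g → F, ∑ i, x i ^ 4 = -1) :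
    fourthLevel F = s := by
  apply le_antisymm
  · exact sInf_le ⟨s, hs, rfl, hx⟩
  · refine le_sInf ?_
    rintro _ ⟨g, hg, rfl, hg'⟩
    by_contra hlt
    exact hmin g hg (by exact_mod_cast not_le.1 hlt) hg'

/-- A representation of `-1` as a sum of fourth powers in a valued field yields one with integral
terms: divide the relation `1 + ∑ xᵢ ^ 4 = 0` by the term of largest valuation and move that term to
the front. -/
theorem Valuation.exists_sum_eq_neg_one {F Γ : Type*} [Field F] [LinearOrderedCommGroupWithZero Γ]
    (v : Valuation F Γ) {g : ℕ} (x : Fin g → F) (hx : ∑ i, x i ^ 4 = -1) :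
    ∃ y : Fin g → F, (∀ i, v (y i) ≤ 1) ∧ ∑ i, y i ^ 4 = -1 := by
  set z : Fin (g + 1) → F := Fin.cons 1 x with hz
  obtain ⟨j, hj⟩ := Finite.exists_max fun i => v (z i)
  have hzj : z j ≠ 0 := by
    intro h0
    have := hj 0
    rw [h0, map_zero, hz, Fin.cons_zero, map_one] at this
    exact not_lt_of_ge this zero_lt_one
  refine ⟨fun i => z (j.succAbove i) / z j, fun i => ?_, ?_⟩
  · rw [map_div₀]
    exact div_le_one_of_le₀ (hj _) zero_le
  · have hsum : ∑ i, z i ^ 4 = 0 := by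
      rw [Fin.sum_univ_succ]
      simp [hz, hx]
    rw [Fin.sum_univ_succAbove _ j] at hsum
    simp only [div_pow]
    rw [← Finset.sum_div, div_eq_iff (pow_ne_zero 4 hzj)]
    linear_combination hsum

/-! ### The completion at the prime ideal -/

section Completion

variable {A : Type*} [CommRing A] [IsDedekindDomain A] {K : Type*} [Field K] [Algebra A K]
  [IsFractionRing A K] (v : HeightOneSpectrum A)

open WithZero

theorem valued_algebraMap_eq_exp {τ : A} (k : ℕ) (h : τ ∈ v.asIdeal ^ k)
    (h' : τ ∉ v.asIdeal ^ (k + 1)) :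
    Valued.v (algebraMap A (v.adicCompletion K) τ) = exp (-(k : ℤ)) := by
  have hv : Valued.v (algebraMap A (v.adicCompletion K) τ) = v.intValuation τ := by
    rw [← v.valuation_of_algebraMap (K := K)]
    exact v.valuedAdicCompletion_eq_valuation τ
  have h0 : v.intValuation τ ≠ 0 := v.intValuation_ne_zero τ (by rintro rfl; simp at h')
  rw [← v.intValuation_le_pow_iff_mem, ← log_le_iff_le_exp h0] at h h'
  rw [hv, ← exp_log h0]
  congr 1
  push_cast at h'
  omega

theorem valued_algebraMap_le_exp_iff (a : A) (k : ℕ) :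
    Valued.v (algebraMap A (v.adicCompletion K) a) ≤ exp (-(k : ℤ)) ↔ a ∈ v.asIdeal ^ k := by
  rw [← v.intValuation_le_pow_iff_mem, ← v.valuation_of_algebraMap (K := K)]
  exact iff_of_eq (congrArg (· ≤ _) (v.valuedAdicCompletion_eq_valuation a))

theorem pow_dvd_iff_valued_le {τ : A} (h : τ ∈ v.asIdeal) (h' : τ ∉ v.asIdeal ^ 2) (k : ℕ)
    (x : v.adicCompletionIntegers K) :
    algebraMap A (v.adicCompletionIntegers K) τ ^ k ∣ x ↔
      Valued.v (x : v.adicCompletion K) ≤ exp (-(k : ℤ)) := by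
  rw [(HeightOneSpectrum.adicCompletionIntegers.integers K v).dvd_iff_le, map_pow, map_pow,
    ← IsScalarTower.algebraMap_apply A, valued_algebraMap_eq_exp v 1 (by simpa using h) h',
    ← exp_nsmul]
  simp

theorem pow_dvd_algebraMap_iff {τ : A} (h : τ ∈ v.asIdeal) (h' : τ ∉ v.asIdeal ^ 2) (k : ℕ)
    (a : A) :
    algebraMap A (v.adicCompletionIntegers K) τ ^ k ∣ algebraMap A (v.adicCompletionIntegers K) a ↔
      a ∈ v.asIdeal ^ k := by
  rw [pow_dvd_iff_valued_le v h h', ← valued_algebraMap_le_exp_iff (K := K)]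
  rfl

theorem isOpen_setOf_pow_dvd {τ : A} (h : τ ∈ v.asIdeal) (h' : τ ∉ v.asIdeal ^ 2) (k : ℕ) :
    IsOpen {x : v.adicCompletion K | Valued.v x ≤ exp (-(k : ℤ))} := by
  have hv := valued_algebraMap_eq_exp (K := K) v 1 (by simpa using h) h'
  set t := algebraMap A (v.adicCompletion K) τ
  have hset : {x : v.adicCompletion K | Valued.v x ≤ exp (-(k : ℤ))} =
      (fun x => x / t ^ k) ⁻¹' ((Valued.v.valuationSubring : ValuationSubring (v.adicCompletion K)) :
        Set (v.adicCompletion K)) := by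
    ext x
    rw [Set.mem_preimage, SetLike.mem_coe, Valuation.mem_valuationSubring_iff, map_div₀, map_pow, hv,
      div_le_one₀ (pow_pos exp_pos k), ← exp_nsmul]
    simp
  rw [hset]
  exact (Valued.isOpen_valuationSubring _).preimage (by fun_prop)

/-- The ring `A` is dense in the completed ring of integers. -/
theorem exists_dvd_sub_algebraMap {τ : A} (h : τ ∈ v.asIdeal) (h' : τ ∉ v.asIdeal ^ 2)
    (x : v.adicCompletionIntegers K) :
    ∃ a : A, algebraMap A (v.adicCompletionIntegers K) τ ∣
      x - algebraMap A (v.adicCompletionIntegers K) a := by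
  have hopen : IsOpen ((fun y : v.adicCompletion K => y - x) ⁻¹'
      {y | Valued.v y ≤ exp (-((1 : ℕ) : ℤ))}) :=
    (isOpen_setOf_pow_dvd v h h' 1).preimage (by fun_prop)
  obtain ⟨k, hk⟩ := (HeightOneSpectrum.denseRange_algebraMap (K := K) v).exists_mem_open hopen
    ⟨x, by simp⟩
  rw [Set.mem_preimage, Set.mem_ofPred_eq] at hk
  have hvk (k : K) : Valued.v (algebraMap K (v.adicCompletion K) k) = v.valuation K k :=
    v.valuedAdicCompletion_eq_valuation' k
  have hk1 : v.valuation K k ≤ 1 := by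
    rw [← hvk, ← sub_add_cancel (algebraMap K (v.adicCompletion K) k) x]
    refine Valuation.map_add_le _ (hk.trans ?_) x.2
    rw [← exp_zero, exp_le_exp]
    norm_num
  obtain ⟨a, ha⟩ := v.exists_valuation_sub_lt_of_integer hk1 (Units.mk0 (exp (-1 : ℤ)) exp_ne_zero)
  refine ⟨a, ?_⟩
  rw [← pow_one (algebraMap A (v.adicCompletionIntegers K) τ), pow_dvd_iff_valued_le v h h']
  have e : ((x - algebraMap A (v.adicCompletionIntegers K) a : v.adicCompletionIntegers K) :
      v.adicCompletion K) = -((algebraMap K (v.adicCompletion K) k - x) +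
        algebraMap K (v.adicCompletion K) (algebraMap A K a - k)) := by
    rw [map_sub, ← IsScalarTower.algebraMap_apply A K]
    change (x : v.adicCompletion K) - algebraMap A (v.adicCompletion K) a = _
    ring
  rw [e, Valuation.map_neg]
  refine Valuation.map_add_le _ hk ?_
  rw [hvk]
  exact ha.le

theorem isDyadicUniformizer {τ : A} (h : τ ∈ v.asIdeal) (h' : τ ∉ v.asIdeal ^ 2)
    (hres : ∀ a : A, a ∈ v.asIdeal ∨ a - 1 ∈ v.asIdeal) (h2 : (2 : A) ∈ v.asIdeal ^ 4)
    (h2' : (2 : A) ∉ v.asIdeal ^ 5) :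
    IsDyadicUniformizer (algebraMap A (v.adicCompletionIntegers K) τ) where
  ne_zero := by
    intro h0
    have := (pow_dvd_algebraMap_iff (K := K) v h h' 2 τ).not.2 h'
    simp [h0] at this
  not_isUnit := by
    intro hu
    have := (pow_dvd_algebraMap_iff (K := K) v h h' 1 1).1 (by simpa using hu.dvd)
    rw [pow_one] at this
    exact v.isPrime.ne_top ((Ideal.eq_top_iff_one _).2 this)
  residue x := by
    obtain ⟨a, ha⟩ := exists_dvd_sub_algebraMap v h h' x
    have key (b : A) (hb : b ∈ v.asIdeal) : algebraMap A (v.adicCompletionIntegers K) τ ∣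
        algebraMap A (v.adicCompletionIntegers K) b := by
      simpa using (pow_dvd_algebraMap_iff (K := K) v h h' 1 b).2 (by simpa using hb)
    rcases hres a with h0 | h1
    · left
      simpa using dvd_add ha (key a h0)
    · right
      simpa using dvd_add ha (key _ h1)
  pow_four := by
    have hdvd : algebraMap A (v.adicCompletionIntegers K) τ ^ 4 ∣ 2 := by
      have := (pow_dvd_algebraMap_iff (K := K) v h h' 4 2).2 h2
      rwa [map_ofNat] at this
    have hdvd' : 2 ∣ algebraMap A (v.adicCompletionIntegers K) τ ^ 4 := by
      have e : algebraMap (v.adicCompletionIntegers K) (v.adicCompletion K) 2 =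
        algebraMap A (v.adicCompletion K) 2 := by rw [map_ofNat, map_ofNat]
      rw [(HeightOneSpectrum.adicCompletionIntegers.integers K v).dvd_iff_le, e,
        valued_algebraMap_eq_exp v 4 h2 h2', map_pow, map_pow, ← IsScalarTower.algebraMap_apply A,
        valued_algebraMap_eq_exp v 1 (by simpa using h) h', ← exp_nsmul]
      simp
    obtain ⟨w, hw⟩ := associated_of_dvd_dvd hdvd' hdvd
    exact ⟨w, w.isUnit, hw.symm⟩

/-- The topology of the completed ring of integers is the adic topology of a uniformizer. -/
theorem isAdicComplete_adicCompletionIntegers {τ : A} (h : τ ∈ v.asIdeal)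
    (h' : τ ∉ v.asIdeal ^ 2) :
    IsAdicComplete (Ideal.span {algebraMap A (v.adicCompletionIntegers K) τ})
      (v.adicCompletionIntegers K) := by
  have : IsTopologicalRing (v.adicCompletionIntegers K) :=
    inferInstanceAs (IsTopologicalRing (v.adicCompletionIntegers K).toSubring)
  have : IsUniformAddGroup (v.adicCompletionIntegers K) :=
    inferInstanceAs (IsUniformAddGroup (v.adicCompletionIntegers K).toSubring.toAddSubgroup)
  have hpow (k : ℕ) : ((Ideal.span {algebraMap A (v.adicCompletionIntegers K) τ} ^ k :
      Ideal (v.adicCompletionIntegers K)) : Set (v.adicCompletionIntegers K)) =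
      Subtype.val ⁻¹' {x : v.adicCompletion K | Valued.v x ≤ exp (-(k : ℤ))} := by
    ext x
    rw [SetLike.mem_coe, Ideal.span_singleton_pow, Ideal.mem_span_singleton,
      pow_dvd_iff_valued_le v h h']
    rfl
  have hadic : IsAdic (Ideal.span {algebraMap A (v.adicCompletionIntegers K) τ}) := by
    rw [isAdic_iff]
    constructor
    · intro k
      rw [hpow]
      exact (isOpen_setOf_pow_dvd v h h' k).preimage continuous_subtype_val
    · intro s hs
      rw [nhds_subtype, Filter.mem_comap] at hs
      obtain ⟨s', hs', hss'⟩ := hs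
      obtain ⟨γ, hγ⟩ := Valued.mem_nhds_zero.1 hs'
      obtain ⟨k, hk⟩ := exists_exp_neg_natCast_lt
        (x := MonoidWithZeroHom.ValueGroup₀.embedding γ.1)
        ((map_ne_zero _).2 γ.ne_zero)
      refine ⟨k, ?_⟩
      rw [hpow]
      refine subset_trans (Set.preimage_mono fun x hx => hγ ?_) hss'
      rw [Set.mem_ofPred_eq, Valuation.restrict_lt_iff_lt_embedding]
      exact lt_of_le_of_lt hx hk
  have hcomplete : CompleteSpace (v.adicCompletionIntegers K) :=
    (Valued.isClosed_valuationSubring (v.adicCompletion K)).completeSpace_coe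
  exact hadic.isAdicComplete_iff.2 ⟨hcomplete, inferInstance⟩

/-- The fourth level of the completion is the number of fourth powers needed to represent `-1`
modulo `τ ^ 13` in its ring of integers, so the table applies to it. -/
theorem levelTable_fourthLevel {τ : A} (h : τ ∈ v.asIdeal) (h' : τ ∉ v.asIdeal ^ 2)
    (hres : ∀ a : A, a ∈ v.asIdeal ∨ a - 1 ∈ v.asIdeal) (h2 : (2 : A) ∈ v.asIdeal ^ 4)
    (h2' : (2 : A) ∉ v.asIdeal ^ 5) :
    ∃ s : ℕ, fourthLevel (v.adicCompletion K) = s ∧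
      LevelTable (fun k l => polyEval τ l ∈ v.asIdeal ^ k) s := by
  have hτ := isDyadicUniformizer (K := K) v h h' hres h2 h2'
  have := isAdicComplete_adicCompletionIntegers (K := K) v h h'
  obtain ⟨s, htable, hex, hmin⟩ := hτ.exists_level
  refine ⟨s, fourthLevel_eq ?_ ?_ ?_, htable.congr fun k _ l _ _ => ?_⟩
  · rcases htable.1 with e | e | e | e <;> omega
  · obtain ⟨x, hx⟩ := hex
    obtain ⟨y, hy⟩ := hτ.exists_sum_eq_neg_one x hx
    have := congrArg Subtype.val hy
    push_cast at this
    exact ⟨fun i => y i, this⟩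
  · rintro g hg hgs ⟨x, hx⟩
    obtain ⟨y, hy, hsum⟩ := Valued.v.exists_sum_eq_neg_one x hx
    refine hmin g hg hgs ⟨fun i => ⟨y i, hy i⟩, ?_⟩
    have : 1 + ∑ i, (⟨y i, hy i⟩ : v.adicCompletionIntegers K) ^ 4 = 0 := by
      apply Subtype.val_injective
      push_cast
      rw [hsum]
      ring
    rw [this]
    exact dvd_zero _
  · rw [← map_polyEval, pow_dvd_algebraMap_iff v h h']

end Completion

/-! ### Ramification and inertia -/

theorem liesOver_span_two {K : Type*} [Field K] (v : HeightOneSpectrum (𝓞 K))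
    (h2 : (2 : 𝓞 K) ∈ v.asIdeal) :
    v.asIdeal.LiesOver (Ideal.span {((2 : ℕ) : ℤ)}) := by
  have hmax : (Ideal.span {((2 : ℕ) : ℤ)}).IsMaximal :=
    PrincipalIdealRing.isMaximal_of_irreducible (Nat.prime_iff_prime_int.1 Nat.prime_two).irreducible
  refine ⟨hmax.eq_of_le (Ideal.IsPrime.ne_top inferInstance) ?_⟩
  rw [Ideal.span_singleton_le_iff_mem, Ideal.under_def, Ideal.mem_comap]
  simpa using h2

section NumberField

variable {K : Type*} [Field K] [NumberField K] (v : HeightOneSpectrum (𝓞 K))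

theorem mem_or_sub_one_mem (h2 : (2 : 𝓞 K) ∈ v.asIdeal)
    (hf : Ideal.inertiaDeg v.asIdeal ℤ = 1) (a : 𝓞 K) : a ∈ v.asIdeal ∨ a - 1 ∈ v.asIdeal := by
  have := liesOver_span_two v h2
  have hcard : Nat.card (𝓞 K ⧸ v.asIdeal) = 2 := by
    have := Ideal.pow_inertiaDeg 2 v.asIdeal
    rw [hf, pow_one, Ideal.absNorm_apply, Submodule.cardQuot_apply] at this
    exact this.symm
  by_contra! hne
  have h3 : ({0, 1, Ideal.Quotient.mk v.asIdeal a} : Set (𝓞 K ⧸ v.asIdeal)).ncard = 3 := by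
    have h1 : (1 : 𝓞 K) ∉ v.asIdeal := (Ideal.ne_top_iff_one _).1 v.isPrime.ne_top
    rw [Set.ncard_eq_three]
    refine ⟨0, 1, _, ?_, ?_, ?_, rfl⟩
    · intro h
      exact h1 (Ideal.Quotient.eq_zero_iff_mem.1 (by rw [map_one, ← h]))
    · intro h
      exact hne.1 (Ideal.Quotient.eq_zero_iff_mem.1 h.symm)
    · intro h
      exact hne.2 (Ideal.Quotient.eq.1 (by rw [map_one, ← h]))
  have : Finite (𝓞 K ⧸ v.asIdeal) := Nat.finite_of_card_ne_zero (by omega)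
  have := Set.ncard_le_card ({0, 1, Ideal.Quotient.mk v.asIdeal a} : Set (𝓞 K ⧸ v.asIdeal))
  omega

theorem two_mem_pow_ramificationIdx (h2 : (2 : 𝓞 K) ∈ v.asIdeal) {e : ℕ}
    (he : Ideal.ramificationIdx v.asIdeal ℤ = e) :
    (2 : 𝓞 K) ∈ v.asIdeal ^ e ∧ (2 : 𝓞 K) ∉ v.asIdeal ^ (e + 1) := by
  have := liesOver_span_two v h2
  have hmap : (Ideal.span {((2 : ℕ) : ℤ)}).map (algebraMap ℤ (𝓞 K)) = Ideal.span {2} := by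
    rw [Ideal.map_span, Set.image_singleton]
    simp
  have hne : Ideal.span {(2 : 𝓞 K)} ≠ ⊥ := by simp
  have hmul := Ideal.IsDedekindDomain.ramificationIdx_eq_multiplicity
    (Ideal.span {((2 : ℕ) : ℤ)}) v.asIdeal (by rwa [hmap])
  rw [hmap, he] at hmul
  have hfin : FiniteMultiplicity v.asIdeal (Ideal.span {(2 : 𝓞 K)}) :=
    FiniteMultiplicity.of_prime_left v.prime hne
  rw [← Ideal.dvd_span_singleton, ← Ideal.dvd_span_singleton]
  exact (hfin.multiplicity_eq_iff).1 hmul.symm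

end NumberField

/-! ### The explicit classification -/

/-- The polynomials in the table are the expressions in the theorem. -/
theorem LevelTable.polyEval_eq {R : Type*} [CommRing R] (τ : R) :
    polyEval τ [2, 0, 0, 0, 1] = τ ^ 4 + 2 ∧
    polyEval τ [4, 0, 0, 4, 0, 0, 2, 0, 1, 0, 0, 0, 1] =
      τ ^ 12 + τ ^ 8 + 2 * τ ^ 6 + 4 * τ ^ 3 + 4 ∧
    polyEval τ [4, 0, 0, 4, 0, 0, 2, 0, 1] = τ ^ 8 + 2 * τ ^ 6 + 4 * τ ^ 3 + 4 ∧
    polyEval τ [4, 0, 4, 4, 0, 0, 0, 0, 1] = τ ^ 8 + 4 * τ ^ 3 + 4 * τ ^ 2 + 4 ∧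
    polyEval τ [4, 0, 4, 4, 0, 0, 0, 0, 1, 0, 0, 0, 1] =
      τ ^ 12 + τ ^ 8 + 4 * τ ^ 3 + 4 * τ ^ 2 + 4 ∧
    polyEval τ [2, 4, 6, 4, 1] = exprA τ 0 ∧
    polyEval τ [2, 4, 2, 0, 3, 0, 2, 0, 1] = exprA τ 1 ∧
    polyEval τ [2, 4, 2, 0, 1] = exprA τ 2 ∧
    polyEval τ [2, 4, 6, 4, 3, 0, 2, 0, 1] = exprA τ 3 ∧
    polyEval τ [2, 4, 6, 4, 1, 0, 0, 0, 1] = exprA τ 0 + τ ^ 8 ∧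
    polyEval τ [2, 4, 2, 0, 3, 0, 2, 0, 2] = exprA τ 1 + τ ^ 8 ∧
    polyEval τ [2, 4, 2, 0, 1, 0, 0, 0, 1] = exprA τ 2 + τ ^ 8 ∧
    polyEval τ [2, 4, 6, 4, 3, 0, 2, 0, 2] = exprA τ 3 + τ ^ 8 ∧
    polyEval τ [4, 0, 0, 4, 2, 0, 0, 0, 0, 0, 0, 0, 1] = τ ^ 12 + 4 * τ ^ 3 + 2 * (τ ^ 4 + 2) ∧
    polyEval τ [2, 0, 0, 0, 1, 0, 0, 0, 1] = τ ^ 8 + τ ^ 4 + 2 ∧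
    polyEval τ [2, 0, 4, 0, 1, 0, 0, 0, 1] = 4 * τ ^ 2 + (τ ^ 8 + τ ^ 4 + 2) ∧
    polyEval τ [2, 0, 0, 4, 1, 0, 0, 0, 1, 0, 0, 0, 1] = τ ^ 12 + 4 * τ ^ 3 + (τ ^ 8 + τ ^ 4 + 2) ∧
    polyEval τ [2, 0, 4, 4, 1, 0, 0, 0, 1, 0, 0, 0, 1] =
      τ ^ 12 + 4 * τ ^ 3 + 4 * τ ^ 2 + (τ ^ 8 + τ ^ 4 + 2) ∧
    polyEval τ [2, 0, 0, 0, 1, 0, 0, 0, 1, 0, 0, 0, 1] = τ ^ 12 + (τ ^ 8 + τ ^ 4 + 2) ∧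
    polyEval τ [2, 0, 4, 0, 1, 0, 0, 0, 1, 0, 0, 0, 1] = τ ^ 12 + 4 * τ ^ 2 + (τ ^ 8 + τ ^ 4 + 2) ∧
    polyEval τ [2, 0, 0, 4, 1, 0, 0, 0, 1] = 4 * τ ^ 3 + (τ ^ 8 + τ ^ 4 + 2) ∧
    polyEval τ [2, 0, 4, 4, 1, 0, 0, 0, 1] = 4 * τ ^ 3 + 4 * τ ^ 2 + (τ ^ 8 + τ ^ 4 + 2) ∧
    polyEval τ [2, 0, 4, 4, 1, 0, 0, 0, 0, 0, 0, 0, 1] =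
      τ ^ 12 + 4 * τ ^ 3 + 4 * τ ^ 2 + τ ^ 4 + 2 ∧
    polyEval τ [2, 0, 4, 0, 1, 0, 0, 0, 0, 0, 0, 0, 1] = τ ^ 12 + 4 * τ ^ 2 + τ ^ 4 + 2 ∧
    polyEval τ [2, 0, 0, 4, 1] = 4 * τ ^ 3 + τ ^ 4 + 2 := by
  refine ⟨?_, ?_, ?_, ?_, ?_, ?_, ?_, ?_, ?_, ?_, ?_, ?_, ?_, ?_, ?_, ?_, ?_, ?_, ?_, ?_, ?_, ?_, ?_, ?_,
    ?_⟩ <;>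
  simp only [polyEval, exprA, Matrix.cons_val] <;> push_cast <;> ring

theorem theorem2p5 (K : Type*) [Field K] [NumberField K]
    (𝔭 : HeightOneSpectrum (𝓞 K)) (h2 : 𝔭.asIdeal ∣ Ideal.span {(2 : 𝓞 K)})
    (he : Ideal.ramificationIdx 𝔭.asIdeal ℤ = 4)
    (hf : Ideal.inertiaDeg 𝔭.asIdeal ℤ = 1)
    (τ : 𝓞 K) (hτ : τ ∈ 𝔭.asIdeal) (hτ' : τ ∉ 𝔭.asIdeal ^ 2)
    (P : Ideal (𝓞 K)) (hP : P = 𝔭.asIdeal)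
    (s : ℕ∞) (hs : s = fourthLevel (𝔭.adicCompletion K)) :
    (s = 1 ∨ s = 2 ∨ s = 3 ∨ s = 4 ∨ s = 5 ∨ s = 6) ∧
    τ ^ 4 + 2 ∈ P ^ 5 ∧
    (ExactlyDivides P 5 (τ ^ 4 + 2) →
      (s = 3 ∨ s = 4 ∨ s = 5 ∨ s = 6) ∧
      (s = 3 ↔ τ ^ 12 + τ ^ 8 + 2 * τ ^ 6 + 4 * τ ^ 3 + 4 ∈ P ^ 13) ∧
      (s = 4 ↔ τ ^ 8 + 2 * τ ^ 6 + 4 * τ ^ 3 + 4 ∈ P ^ 13) ∧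
      (s = 5 ↔ τ ^ 8 + 4 * τ ^ 3 + 4 * τ ^ 2 + 4 ∈ P ^ 13) ∧
      (s = 6 ↔ τ ^ 12 + τ ^ 8 + 4 * τ ^ 3 + 4 * τ ^ 2 + 4 ∈ P ^ 13)) ∧
    (ExactlyDivides P 6 (τ ^ 4 + 2) →
      (s = 1 ∨ s = 2 ∨ s = 3) ∧
      (s = 1 ↔ ∃ i, exprA τ i ∈ P ^ 13) ∧
      (s = 2 ↔ (∃ i, ExactlyDivides P 12 (exprA τ i)) ∨ ∃ i, exprA τ i + τ ^ 8 ∈ P ^ 12)) ∧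
    (ExactlyDivides P 7 (τ ^ 4 + 2) →
      (s = 3 ∨ s = 4) ∧
      (s = 3 ↔ τ ^ 12 + 4 * τ ^ 3 + 2 * (τ ^ 4 + 2) ∈ P ^ 13)) ∧
    (ExactlyDivides P 8 (τ ^ 4 + 2) →
      (s = 2 ∨ s = 3 ∨ s = 4) ∧
      (s = 2 ↔
        τ ^ 8 + τ ^ 4 + 2 ∈ P ^ 13 ∨
        4 * τ ^ 2 + (τ ^ 8 + τ ^ 4 + 2) ∈ P ^ 13 ∨
        τ ^ 12 + 4 * τ ^ 3 + (τ ^ 8 + τ ^ 4 + 2) ∈ P ^ 13 ∨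
        τ ^ 12 + 4 * τ ^ 3 + 4 * τ ^ 2 + (τ ^ 8 + τ ^ 4 + 2) ∈ P ^ 13) ∧
      (s = 3 ↔
        τ ^ 12 + (τ ^ 8 + τ ^ 4 + 2) ∈ P ^ 13 ∨
        τ ^ 12 + 4 * τ ^ 2 + (τ ^ 8 + τ ^ 4 + 2) ∈ P ^ 13 ∨
        4 * τ ^ 3 + (τ ^ 8 + τ ^ 4 + 2) ∈ P ^ 13 ∨
        4 * τ ^ 3 + 4 * τ ^ 2 + (τ ^ 8 + τ ^ 4 + 2) ∈ P ^ 13) ∧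
      (s = 4 ↔ ExactlyDivides P 9 (τ ^ 8 + τ ^ 4 + 2))) ∧
    (ExactlyDivides P 9 (τ ^ 4 + 2) → s = 4) ∧
    (ExactlyDivides P 10 (τ ^ 4 + 2) →
      (s = 2 ∨ s = 3) ∧
      (s = 2 ↔
        τ ^ 12 + 4 * τ ^ 3 + 4 * τ ^ 2 + τ ^ 4 + 2 ∈ P ^ 13 ∨
        τ ^ 12 + 4 * τ ^ 2 + τ ^ 4 + 2 ∈ P ^ 13)) ∧
    (ExactlyDivides P 11 (τ ^ 4 + 2) →
      (s = 2 ∨ s = 3) ∧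
      (s = 2 ↔ 4 * τ ^ 3 + τ ^ 4 + 2 ∈ P ^ 13)) ∧
    (ExactlyDivides P 12 (τ ^ 4 + 2) → s = 3) ∧
    (τ ^ 4 + 2 ∈ P ^ 13 → s = 2) := by
  subst hP
  have h2' : (2 : 𝓞 K) ∈ 𝔭.asIdeal := Ideal.dvd_span_singleton.1 h2
  obtain ⟨h24, h25⟩ := two_mem_pow_ramificationIdx 𝔭 h2' he
  obtain ⟨n, hn, htable⟩ := levelTable_fourthLevel (K := K) 𝔭 hτ hτ' (mem_or_sub_one_mem 𝔭 h2' hf)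
    h24 h25
  rw [hn] at hs
  have hcast (m : ℕ) [m.AtLeastTwo] : s = OfNat.ofNat m ↔ n = OfNat.ofNat m := by
    rw [hs]; exact ENat.natCast_inj
  have hcast1 : s = 1 ↔ n = 1 := by rw [hs]; exact ENat.natCast_inj
  have hexists (Q : Fin 4 → Prop) : (∃ i, Q i) ↔ Q 0 ∨ Q 1 ∨ Q 2 ∨ Q 3 := by
    simp only [Fin.exists_fin_succ, Fin.exists_fin_zero, or_false]; rfl
  simp only [hcast, hcast1, ExactlyDivides, hexists, Nat.reduceAdd]
  simp only [LevelTable, LevelTable.polyEval_eq] at htable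
  obtain ⟨h1, h5, c5, c⟩ := htable
  refine ⟨by omega, h5, fun h => ?_, c⟩
  -- In the first case the level is always `3`, and the conditions for `4`, `5`, `6` never hold.
  obtain ⟨hn3, d3, d4, d5, d6⟩ := c5 h
  refine ⟨Or.inl hn3, iff_of_true hn3 d3, iff_of_false ?_ d4, iff_of_false ?_ d5,
    iff_of_false ?_ d6⟩ <;> omega
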